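/- Let $E$ be a real or complex Hilbert space and let $M\subseteq E$ be an embedded submanifold, i.e. a subset which, with the subspace topology, is a $C^\infty$ manifold modelled on a Banach space over the same field, such that the inclusion $M\hookrightarrow E$ is smooth and its differential at each point is injective with closed image. (Over $\mathbb{C}$, smooth charts and inclusion are understood in the sense of complex differentiability.) For $p\in M$ let $T_pM\subseteq E$ be the tangent space (the image of the differential of the inclusion), let $N_pM=(T_pM)^\perp$, and let $TM=\{(p,v): p\in M,\ v\in T_pM\}$ carry the topology induced from $E\times E$. A map $R$ with values in $M$, defined on an open subset $U$ of $TM$, is called a retraction on $U$ if it is $C^\infty$ in the real sense (i.e. locally the restriction of a real-$C^\infty$ map from an open subset of $E\times E$ to $E$) and if, for all $(p,0)\in U$, $R(p,0)=p$ and the map $R_p=R(p,\cdot)$, defined near $0$ in $T_pM$, has Fréchet derivative $DR_p(0)=\mathrm{id}_{T_pM}$. Then for every $\hat p\in M$ there is an open neighbourhood $U$ of $(\hat p,0)$ in $TM$ such that: 1. for every $(p,v)\in U$, among all $w\in N_pM$ with $p+v+w\in M$ there is one and only one of smallest norm; denote it by $w(p,v)$ and put $R(p,v)=p+v+w(p,v)$;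 2. $D_v w(p,0)=0$ for all $(p,0)\in U$, i.e. the map $v\mapsto w(p,v)$, defined near $0$ in $T_pM$, is Fréchet differentiable at $0$ with derivative $0$; 3. $R$ is a retraction on $U$. Moreover, $R$ is a retraction on $M$: there is an open subset $U$ of $TM$ containing $(p,0)$ for all $p\in M$ such that the unique smallest $w(p,v)$ exists for every $(p,v)\in U$ and $R(p,v)=p+v+w(p,v)$ is a retraction on $U$. -/

import Mathlib

open scoped Manifold ContDiff Topology

noncomputable section

namespace Orthographic

variable (𝕜 : Type*) [RCLike 𝕜]
  {E : Type*} [NormedAddCommGroup E] [InnerProductSpace 𝕜 E]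
  (F : Type*) [NormedAddCommGroup F] [NormedSpace 𝕜 F]

variable {M : Set E} [ChartedSpace F M]

/-- The tangent space `T_p M`, as a subspace of the ambient space `E`: the image of the
differential of the inclusion `M → E` at `p`. -/
def tangentSubspace (p : M) : Submodule 𝕜 E :=
  LinearMap.range
    (mfderiv 𝓘(𝕜, F) 𝓘(𝕜, E) (Subtype.val : M → E) p : F →L[𝕜] E).toLinearMap

variable (M) in
/-- The subset `M` of the Hilbert space `E`, with the subspace topology and the atlas given by the
`ChartedSpace F M` instance (charts with values in the Banach space `F`), is a smooth embedded
submanifold: it is a smooth manifold and the inclusion is smooth, with injective differentials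
whose ranges are closed. That the inclusion is a homeomorphism onto its image is automatic, since
the type `M` carries the subspace topology. -/
structure IsEmbeddedSubmanifold : Prop where
  isManifold : IsManifold 𝓘(𝕜, F) ∞ M
  contMDiff_val : ContMDiff 𝓘(𝕜, F) 𝓘(𝕜, E) ∞ (Subtype.val : M → E)
  injective_mfderiv : ∀ p : M,
    Function.Injective (mfderiv 𝓘(𝕜, F) 𝓘(𝕜, E) (Subtype.val : M → E) p)
  isClosed_tangentSubspace : ∀ p : M,
    IsClosed (tangentSubspace 𝕜 F p : Set E)

/-- The normal space `N_p M = (T_p M)ᗮ`. -/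
def normalSubspace (p : M) : Submodule 𝕜 E := (tangentSubspace 𝕜 F p)ᗮ

variable (M) in
/-- The tangent bundle `TM = {(p, v) | p ∈ M, v ∈ T_p M}`, as a subset of `M × E`. -/
def tangentBundleSet : Set (M × E) := {x | x.2 ∈ tangentSubspace 𝕜 F x.1}

/-- `U` is an open subset of the tangent bundle `TM` (with the topology of `M × E`). -/
def IsOpenInTangentBundle (U : Set (M × E)) : Prop :=
  ∃ O : Set (M × E), IsOpen O ∧ U = O ∩ tangentBundleSet 𝕜 F M

/-- `w` is a smallest (in norm) vector of `N_p M` such that `p + v + w ∈ M`. -/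
def IsSmallestNormal (p : M) (v w : E) : Prop :=
  w ∈ normalSubspace 𝕜 F p ∧ (p : E) + v + w ∈ M ∧
    ∀ w' ∈ normalSubspace 𝕜 F p, (p : E) + v + w' ∈ M → ‖w‖ ≤ ‖w'‖

open Classical in
/-- `w(p, v)`: the unique smallest `w ∈ N_p M` with `p + v + w ∈ M`. The value is `0` where there
is no such vector or more than one. -/
def orthographicNormal (x : M × E) : E :=
  if h : ∃! w : E, IsSmallestNormal 𝕜 F x.1 x.2 w then h.choose else 0

/-- `R(p, v) = p + v + w(p, v)`. -/
def orthographicMap (x : M × E) : E :=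
  (x.1 : E) + x.2 + orthographicNormal 𝕜 F x

/-- `f : M × E → E` is smooth on `U ⊆ TM`: near each point of `U` it agrees on `U` with a map that
is `C^∞` (over the reals) on an open subset of the ambient space `E × E`. -/
def IsSmoothOn [NormedSpace ℝ E] (f : M × E → E) (U : Set (M × E)) : Prop :=
  ∀ x ∈ U, ∃ (O : Set (E × E)) (g : E × E → E),
    IsOpen O ∧ ((x.1 : E), x.2) ∈ O ∧ ContDiffOn ℝ ∞ g O ∧
      ∀ y ∈ U, ((y.1 : E), y.2) ∈ O → g ((y.1 : E), y.2) = f y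

/-- `R` is a retraction with domain the subset `U` of the tangent bundle: it maps `U` smoothly to
`M`, and `R_p(0) = p` and `D R_p(0) = id` whenever `(p, 0) ∈ U`. -/
structure IsRetractionOn [NormedSpace ℝ E] (R : M × E → E) (U : Set (M × E)) : Prop where
  isOpen : IsOpenInTangentBundle 𝕜 F U
  mem : ∀ x ∈ U, R x ∈ M
  smooth : IsSmoothOn R U
  map_zero : ∀ p : M, (p, (0 : E)) ∈ U → R (p, 0) = p
  hasFDerivAt_zero : ∀ p : M, (p, (0 : E)) ∈ U →
    HasFDerivAt (fun v : tangentSubspace 𝕜 F p => R (p, (v : E)))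
      (tangentSubspace 𝕜 F p).subtypeL 0

end Orthographic

end

/-! Near `p₀`, parametrize `M` by an inverse chart `ψ`. With `p = ψ a` and `q = ψ b`, the condition
`q - p - v ∈ N_p M` says that `b` solves `⟪ψ b - ψ a - v, Dψ(a) y⟫ = 0` for all `y`; over `ℂ` the
real part of the inner product suffices. This is an equation in the real dual of `F`, and its
`b`-derivative at `a = b = a₀`, `v = 0` is the Gram operator of `Dψ(a₀)`. As `Dψ(a₀)` is injective
with closed range, `bijective_gram` makes that operator invertible by Riesz, and the implicit
function theorem yields a smooth solution `b = β (a, v)`, for all small `v ∈ E`, tangent or not.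

Put `η = ψ (β (a, v)) - p - v`. A normal competitor no longer than `η` leads to a point of `M` close
to `p₀` in `E`, hence inside the patch because `M` has the subspace topology; local uniqueness of
`b` then forces it to be `η`. So `η` is the unique smallest vector.

The `v`-derivative of `η` at `0` is `Dψ ∘ β' - id`, which maps `T_p M` to itself, while `η` is
normal-valued; hence it vanishes on `T_p M`. Finally, `w(p, v)` does not depend on the patch, so the
local domains can simply be united. -/

namespace Orthographic

/-! ### Inverse and implicit functions, smooth on full neighbourhoods -/

section Calculus

variable {X Y Z : Type*} [NormedAddCommGroup X] [NormedSpace ℝ X] [CompleteSpace X]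
  [NormedAddCommGroup Y] [NormedSpace ℝ Y] [CompleteSpace Y]
  [NormedAddCommGroup Z] [NormedSpace ℝ Z]

/-- Inverse function theorem with a local inverse that is `C^∞` on a whole neighbourhood. -/
theorem exists_openPartialHomeomorph_contDiffOn_symm {f : X → Z} {S : Set X} (hS : IsOpen S)
    (hf : ContDiffOn ℝ ∞ f S) {a : X} (ha : a ∈ S) {f' : X ≃L[ℝ] Z}
    (hf' : HasFDerivAt f (f' : X →L[ℝ] Z) a) :
    ∃ e : OpenPartialHomeomorph X Z, a ∈ e.source ∧ e.source ⊆ S ∧ (∀ x, e x = f x) ∧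
      ContDiffOn ℝ ∞ e.symm e.target := by
  have hfa : ContDiffAt ℝ ∞ f a := hf.contDiffAt (hS.mem_nhds ha)
  have hcont : ContinuousOn (fderiv ℝ f) S := hf.continuousOn_fderiv_of_isOpen hS (by simp)
  -- Invertible operators form an open set, so invertibility of the derivative persists on the open
  -- set `S'`, and the inverse is smooth at every target point. `C^∞` at a single point would only
  -- give neighbourhoods depending on the order.
  let S' : Set X := S ∩ fderiv ℝ f ⁻¹' Set.range ((↑) : (X ≃L[ℝ] Z) → X →L[ℝ] Z)
  have hS' : IsOpen S' := hcont.isOpen_inter_preimage hS ContinuousLinearEquiv.isOpen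
  have haS' : a ∈ S' := ⟨ha, f', hf'.fderiv.symm⟩
  refine ⟨(hfa.toOpenPartialHomeomorph f hf' (by simp)).restrOpen S' hS', ?_, ?_, ?_, ?_⟩
  · exact ⟨hfa.mem_toOpenPartialHomeomorph_source hf' (by simp), haS'⟩
  · exact fun x hx => hx.2.1
  · exact fun x => rfl
  · intro z hz
    set e := (hfa.toOpenPartialHomeomorph f hf' (by simp)).restrOpen S' hS'
    have hx : e.symm z ∈ e.source := e.map_target hz
    obtain ⟨hxS, g, hg⟩ : e.symm z ∈ S' := hx.2
    have hd : ContDiffAt ℝ ∞ f (e.symm z) := hf.contDiffAt (hS.mem_nhds hxS)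
    refine (e.contDiffAt_symm (f₀' := g) hz ?_ hd).contDiffWithinAt
    rw [hg]
    exact (hd.differentiableAt (by simp)).hasFDerivAt

/-- Implicit function theorem with an implicit function that is `C^∞` on a whole neighbourhood. -/
theorem exists_implicitFunction_contDiffOn {G : X × Y → Z} {S : Set (X × Y)} (hS : IsOpen S)
    (hG : ContDiffOn ℝ ∞ G S) {x₀ : X} {y₀ : Y} (h₀ : (x₀, y₀) ∈ S) (hG₀ : G (x₀, y₀) = 0)
    {G' : Y ≃L[ℝ] Z} (hG' : HasFDerivAt (fun y => G (x₀, y)) (G' : Y →L[ℝ] Z) y₀) :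
    ∃ (V : Set X) (W : Set Y) (β : X → Y), IsOpen V ∧ x₀ ∈ V ∧ IsOpen W ∧ y₀ ∈ W ∧
      V ×ˢ W ⊆ S ∧ ContDiffOn ℝ ∞ β V ∧
      ∀ x ∈ V, β x ∈ W ∧ ∀ y ∈ W, G (x, y) = 0 ↔ y = β x := by
  have hGd : HasFDerivAt G (fderiv ℝ G (x₀, y₀)) (x₀, y₀) :=
    ((hG.contDiffAt (hS.mem_nhds h₀)).differentiableAt (by simp)).hasFDerivAt
  set D := fderiv ℝ G (x₀, y₀)
  have hD : ∀ y, D (0, y) = G' y := by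
    have h := HasFDerivAt.comp y₀ (f := fun y => (x₀, y)) hGd (hasFDerivAt_prodMk_right x₀ y₀)
    intro y
    exact congrArg (fun T : Y →L[ℝ] Z => T y) (h.unique hG')
  -- The derivative of `(x, y) ↦ (x, G (x, y))` is block triangular with diagonal `id`, `G'`.
  let Φ' : (X × Y) ≃L[ℝ] (X × Z) :=
    (ContinuousLinearEquiv.refl ℝ X).skewProd G' (D.comp (ContinuousLinearMap.inl ℝ X Y))
  have hΦ' : HasFDerivAt (fun z : X × Y => (z.1, G z)) (Φ' : X × Y →L[ℝ] X × Z) (x₀, y₀) := by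
    convert! hasFDerivAt_fst.prodMk hGd using 1
    refine ContinuousLinearMap.ext fun ⟨x, y⟩ => ?_
    have : D (x, y) = D (x, 0) + D (0, y) := by rw [← map_add]; simp
    simp [Φ', this, hD, add_comm]
  obtain ⟨e, hmem, hsub, he, hsymm⟩ := exists_openPartialHomeomorph_contDiffOn_symm hS
    (contDiffOn_fst.prodMk hG) h₀ hΦ'
  obtain ⟨V₁, hV₁, W, hW, hVW⟩ := mem_nhds_prod_iff.1 (e.open_source.mem_nhds hmem)
  obtain ⟨V₁, hV₁s, hV₁o, hxV₁⟩ := mem_nhds_iff.1 hV₁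
  obtain ⟨W, hWs, hWo, hyW⟩ := mem_nhds_iff.1 hW
  replace hVW : V₁ ×ˢ W ⊆ e.source := (Set.prod_mono hV₁s hWs).trans hVW
  have hpair : Continuous fun x : X => (x, (0 : Z)) := by fun_prop
  let V₂ : Set X := (fun x : X => (x, (0 : Z))) ⁻¹' e.target
  have hV₂ : IsOpen V₂ := e.open_target.preimage hpair
  let β : X → Y := fun x => (e.symm (x, 0)).2
  have hβ : ContDiffOn ℝ ∞ β V₂ :=
    (hsymm.comp (contDiff_id.prodMk contDiff_const).contDiffOn fun x hx => hx).snd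
  have hfix : ∀ x ∈ V₂, e.symm (x, 0) = (x, β x) ∧ G (x, β x) = 0 := by
    intro x hx
    have h1 : e (e.symm (x, 0)) = (x, 0) := e.right_inv hx
    rw [he] at h1
    have h2 : e.symm (x, 0) = (x, β x) := Prod.ext (Prod.ext_iff.1 h1).1 rfl
    rw [h2] at h1
    exact ⟨h2, congrArg Prod.snd h1⟩
  have he₀ : e (x₀, y₀) = (x₀, 0) := by rw [he, hG₀]
  have hx₀ : x₀ ∈ V₂ := by
    change (x₀, (0 : Z)) ∈ e.target
    rw [← he₀]
    exact e.map_source hmem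
  have hβ₀ : β x₀ = y₀ := by
    change (e.symm (x₀, 0)).2 = y₀
    rw [← he₀, e.left_inv hmem]
  -- `V₁` gives uniqueness (injectivity of `e` on `V₁ ×ˢ W`), `V₂` existence, and `β ⁻¹' W` keeps
  -- the solution in `W`.
  refine ⟨V₁ ∩ (V₂ ∩ β ⁻¹' W), W, β, hV₁o.inter (hβ.continuousOn.isOpen_inter_preimage hV₂ hWo),
    ⟨hxV₁, hx₀, by simpa [hβ₀] using hyW⟩, hWo, hyW, ?_, hβ.mono fun x hx => hx.2.1, ?_⟩
  · exact (Set.prod_mono_left Set.inter_subset_left).trans (hVW.trans hsub)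
  · rintro x ⟨hx₁, hx₂, hxW⟩
    refine ⟨hxW, fun y hy => ⟨fun h => ?_, fun h => h ▸ (hfix x hx₂).2⟩⟩
    have hxy : (x, y) ∈ e.source := hVW ⟨hx₁, hy⟩
    have : e.symm (e (x, y)) = (x, y) := e.left_inv hxy
    rw [he, h] at this
    exact (congrArg Prod.snd this).symm

end Calculus

/-! ### The orthogonality equation over the reals -/

section NormalEquation

variable {E F : Type*} [NormedAddCommGroup E] [InnerProductSpace ℝ E] [CompleteSpace E]
  [NormedAddCommGroup F] [NormedSpace ℝ F] [CompleteSpace F]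

/-- The Gram operator of an injective operator with closed range is invertible. -/
theorem bijective_gram {A : F →L[ℝ] E} (hA : Function.Injective A)
    (hcl : IsClosed (Set.range A)) {Γ : F →L[ℝ] F →L[ℝ] ℝ}
    (hΓ : ∀ x y, Γ x y = inner ℝ (A x) (A y)) : Function.Bijective Γ := by
  constructor
  · rw [injective_iff_map_eq_zero]
    intro x hx
    have : inner ℝ (A x) (A x) = 0 := by rw [← hΓ, hx]; rfl
    exact hA (by rw [inner_self_eq_zero.1 this, map_zero])
  · intro l
    have : CompleteSpace A.range := IsClosed.completeSpace_coe (s := Set.range A)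
    let e := A.equivRange hA hcl
    have he : ∀ x, (e x : E) = A x := fun x => rfl
    -- Transport `l` to the range of `A`, which is complete because closed, and represent it there
    -- by Riesz.
    let t := (InnerProductSpace.toDual ℝ A.range).symm (l.comp (e.symm : A.range →L[ℝ] F))
    refine ⟨e.symm t, ?_⟩
    ext y
    rw [hΓ, ← he, ← he, e.apply_symm_apply, ← Submodule.coe_inner,
      InnerProductSpace.toDual_symm_apply]
    simp

/-- A smooth parametrization whose derivative at a point is injective with closed range has, near
that point, a left inverse that is smooth on an open subset of the ambient space. -/
theorem exists_contDiffOn_leftInverse {ψ : F → E} {Ω : Set F} (hΩ : IsOpen Ω)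
    (hψ : ContDiffOn ℝ ∞ ψ Ω) {a₀ : F} (ha₀ : a₀ ∈ Ω)
    (hinj : Function.Injective (fderiv ℝ ψ a₀)) (hcl : IsClosed (Set.range (fderiv ℝ ψ a₀))) :
    ∃ (O : Set E) (W : Set F) (ρ : E → F), IsOpen O ∧ IsOpen W ∧ a₀ ∈ W ∧
      ContDiffOn ℝ ∞ ρ O ∧ ∀ a ∈ W, ψ a ∈ O ∧ ρ (ψ a) = a := by
  set A := fderiv ℝ ψ a₀ with hA
  have : CompleteSpace A.range := IsClosed.completeSpace_coe (s := Set.range A)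
  let e := A.equivRange hinj hcl
  have he : ∀ x, (e x : E) = A x := fun x => rfl
  -- `L` inverts `A` after projecting onto its range, so `L ∘ ψ` has derivative `id` at `a₀`; the
  -- left inverse is `(L ∘ ψ)⁻¹ ∘ L`.
  let L : E →L[ℝ] F := (e.symm : A.range →L[ℝ] F).comp A.range.orthogonalProjectionOnto
  have hLA : ∀ x, L (A x) = x := fun x => by
    simp only [L, ContinuousLinearMap.comp_apply]
    rw [← he, Submodule.orthogonalProjectionOnto_mem_subspace_eq_self]
    simp
  have hd : HasFDerivAt (fun a => L (ψ a)) ((ContinuousLinearEquiv.refl ℝ F : F ≃L[ℝ] F) :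
      F →L[ℝ] F) a₀ := by
    have h1 : HasFDerivAt ψ A a₀ :=
      ((hψ.contDiffAt (hΩ.mem_nhds ha₀)).differentiableAt (by simp)).hasFDerivAt
    convert! L.hasFDerivAt.comp a₀ h1 using 1
    ext x
    simp [hLA]
  obtain ⟨h, hmem, -, heq, hsm⟩ := exists_openPartialHomeomorph_contDiffOn_symm hΩ
    (L.contDiff.comp_contDiffOn hψ) ha₀ hd
  refine ⟨L ⁻¹' h.target, h.source, fun x => h.symm (L x), h.open_target.preimage L.continuous,
    h.open_source, hmem, hsm.comp L.contDiff.contDiffOn fun x hx => hx, fun a ha => ?_⟩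
  have : L (ψ a) = h a := (heq a).symm
  refine ⟨?_, ?_⟩
  · change L (ψ a) ∈ h.target
    rw [this]
    exact h.map_source ha
  · change h.symm (L (ψ a)) = a
    rw [this, h.left_inv ha]

/-- Local solvability of the orthogonality equation `ψ b - ψ a - v ⟂ range (Dψ a)` for `b`. -/
theorem exists_contDiffOn_solution_normalEquation {ψ : F → E} {Ω : Set F} (hΩ : IsOpen Ω)
    (hψ : ContDiffOn ℝ ∞ ψ Ω) {a₀ : F} (ha₀ : a₀ ∈ Ω)
    (hinj : Function.Injective (fderiv ℝ ψ a₀)) (hcl : IsClosed (Set.range (fderiv ℝ ψ a₀))) :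
    ∃ (V : Set (F × E)) (W : Set F) (β : F × E → F), IsOpen V ∧ (a₀, 0) ∈ V ∧ IsOpen W ∧ a₀ ∈ W ∧
      W ⊆ Ω ∧ ContDiffOn ℝ ∞ β V ∧
      ∀ x ∈ V, x.1 ∈ Ω ∧ β x ∈ W ∧ ∀ b ∈ W,
        (∀ y, inner ℝ (ψ b - ψ x.1 - x.2) (fderiv ℝ ψ x.1 y) = 0) ↔ b = β x := by
  let B : E →L[ℝ] E →L[ℝ] ℝ := innerSL ℝ
  let G : (F × E) × F → F →L[ℝ] ℝ := fun z =>
    (B (ψ z.2 - ψ z.1.1 - z.1.2)).comp (fderiv ℝ ψ z.1.1)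
  let S : Set ((F × E) × F) := {z | z.1.1 ∈ Ω ∧ z.2 ∈ Ω}
  have hS : IsOpen S := (hΩ.preimage (by fun_prop)).inter (hΩ.preimage (by fun_prop))
  have hG : ContDiffOn ℝ ∞ G S := by
    have h1 : ContDiffOn ℝ ∞ (fun z : (F × E) × F => ψ z.1.1) S :=
      hψ.comp (by fun_prop) fun z hz => hz.1
    have h2 : ContDiffOn ℝ ∞ (fun z : (F × E) × F => ψ z.2) S :=
      hψ.comp (by fun_prop) fun z hz => hz.2
    have h3 : ContDiffOn ℝ ∞ (fun z : (F × E) × F => fderiv ℝ ψ z.1.1) S :=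
      (hψ.fderiv_of_isOpen hΩ (m := ∞) (by simp)).comp
        (contDiff_fst.fst.contDiffOn) fun z hz => hz.1
    have h4 : ContDiffOn ℝ ∞ (fun z : (F × E) × F => z.1.2) S := contDiff_fst.snd.contDiffOn
    exact (B.contDiff.comp_contDiffOn ((h2.sub h1).sub h4)).clm_comp h3
  set A := fderiv ℝ ψ a₀ with hA
  have hψ' : HasFDerivAt ψ A a₀ :=
    ((hψ.contDiffAt (hΩ.mem_nhds ha₀)).differentiableAt (by simp)).hasFDerivAt
  -- With `a = a₀` and `v = 0` fixed, `G` is the linear map `Λ` applied to `ψ b - ψ a₀`, so its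
  -- derivative is the Gram operator `Λ ∘ A`.
  let Λ : E →L[ℝ] F →L[ℝ] ℝ := ((ContinuousLinearMap.compL ℝ F E ℝ).flip A).comp B
  have hbij : Function.Bijective (Λ.comp A) := bijective_gram hinj hcl fun x y => rfl
  let Γ : F ≃L[ℝ] F →L[ℝ] ℝ := ContinuousLinearEquiv.ofBijective (Λ.comp A)
    (LinearMap.ker_eq_bot.2 hbij.1) (LinearMap.range_eq_top.2 hbij.2)
  have hΓ : (Γ : F →L[ℝ] F →L[ℝ] ℝ) = Λ.comp A := rfl
  have hG' : HasFDerivAt (fun b => G ((a₀, 0), b)) (Γ : F →L[ℝ] F →L[ℝ] ℝ) a₀ := by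
    rw [hΓ]
    exact Λ.hasFDerivAt.comp a₀ ((hψ'.sub_const (ψ a₀)).sub_const 0)
  obtain ⟨V, W, β, hV, haV, hW, haW, hsub, hβ, hsol⟩ := exists_implicitFunction_contDiffOn hS hG
    (x₀ := (a₀, 0)) (y₀ := a₀) ⟨ha₀, ha₀⟩ (by simp [G]) hG'
  refine ⟨V, W, β, hV, haV, hW, haW, fun b hb => (hsub (Set.mk_mem_prod haV hb)).2, hβ,
    fun x hx => ⟨(hsub (Set.mk_mem_prod hx haW)).1, (hsol x hx).1, fun b hb => ?_⟩⟩
  rw [← (hsol x hx).2 b hb, ContinuousLinearMap.ext_iff]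
  rfl

end NormalEquation

/-! ### Passing between `𝕜` and the reals -/

section Orthogonality

variable {𝕜 : Type*} [RCLike 𝕜] {E : Type*} [NormedAddCommGroup E] [InnerProductSpace 𝕜 E]

theorem mem_orthogonal_iff_re_inner_eq_zero (K : Submodule 𝕜 E) (w : E) :
    w ∈ Kᗮ ↔ ∀ u ∈ K, RCLike.re (inner 𝕜 w u) = 0 := by
  rw [Submodule.mem_orthogonal']
  refine ⟨fun h u hu => by rw [h u hu, map_zero], fun h u hu => ?_⟩
  -- This multiple of `u` turns the inner product into the real number `‖⟪w, u⟫‖ ^ 2`.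
  have h1 := h (inner 𝕜 u w • u) (K.smul_mem _ hu)
  rw [inner_smul_right, ← inner_conj_symm u w, RCLike.conj_mul] at h1
  norm_cast at h1
  simpa using h1

/-- The real inner product space underlying a `𝕜`-inner product space, for a given compatible
real normed space structure. -/
@[reducible]
def realInnerProductSpace (𝕜 E : Type*) [RCLike 𝕜] [NormedAddCommGroup E] [InnerProductSpace 𝕜 E]
    [inst : NormedSpace ℝ E] [IsScalarTower ℝ 𝕜 E] : InnerProductSpace ℝ E :=
  { inst with
    inner := fun x y => RCLike.re (inner 𝕜 x y)
    norm_sq_eq_re_inner := fun x => norm_sq_eq_re_inner (𝕜 := 𝕜) x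
    conj_inner_symm := fun x y => inner_re_symm (𝕜 := 𝕜) _ _
    add_left := fun x y z => by rw [inner_add_left, map_add]
    smul_left := fun x y r => by
      rw [← algebraMap_smul 𝕜 r x, inner_smul_left, RCLike.algebraMap_eq_ofReal,
        RCLike.conj_ofReal, RCLike.re_ofReal_mul]
      rfl }

variable [CompleteSpace E] [NormedSpace ℝ E] [IsScalarTower ℝ 𝕜 E]
  {F : Type*} [NormedAddCommGroup F] [NormedSpace 𝕜 F] [CompleteSpace F]
  [NormedSpace ℝ F] [IsScalarTower ℝ 𝕜 F]

/-- Local data for the orthographic projection near a point of an immersed patch: the solution `β`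
of the normal equation and a smooth left inverse `ρ` of the parametrization. -/
theorem exists_normalSolution_leftInverse {ψ : F → E} {Ω : Set F} (hΩ : IsOpen Ω)
    (hψ : ContDiffOn 𝕜 ∞ ψ Ω) {a₀ : F} (ha₀ : a₀ ∈ Ω)
    (hinj : Function.Injective (fderiv 𝕜 ψ a₀)) (hcl : IsClosed (Set.range (fderiv 𝕜 ψ a₀))) :
    (∃ (V : Set (F × E)) (W : Set F) (β : F × E → F), IsOpen V ∧ (a₀, 0) ∈ V ∧ IsOpen W ∧
      a₀ ∈ W ∧ W ⊆ Ω ∧ ContDiffOn ℝ ∞ β V ∧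
      ∀ x ∈ V, β x ∈ W ∧ ∀ b ∈ W,
        ψ b - ψ x.1 - x.2 ∈ (LinearMap.range (fderiv 𝕜 ψ x.1).toLinearMap)ᗮ ↔ b = β x) ∧
    ∃ (O : Set E) (W : Set F) (ρ : E → F), IsOpen O ∧ IsOpen W ∧ a₀ ∈ W ∧
      ContDiffOn ℝ ∞ ρ O ∧ ∀ a ∈ W, ψ a ∈ O ∧ ρ (ψ a) = a := by
  let _ : InnerProductSpace ℝ E := realInnerProductSpace 𝕜 E
  have hψr : ContDiffOn ℝ ∞ ψ Ω := hψ.restrict_scalars ℝ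
  have hfd : ∀ a ∈ Ω, ∀ y, fderiv ℝ ψ a y = fderiv 𝕜 ψ a y := fun a ha y => by
    rw [((hψ.contDiffAt (hΩ.mem_nhds ha)).differentiableAt (by simp)).fderiv_restrictScalars ℝ]
    rfl
  have hfd₀ : (fderiv ℝ ψ a₀ : F → E) = fderiv 𝕜 ψ a₀ := funext (hfd a₀ ha₀)
  rw [← hfd₀] at hinj hcl
  refine ⟨?_, exists_contDiffOn_leftInverse hΩ hψr ha₀ hinj hcl⟩
  obtain ⟨V, W, β, hV, haV, hW, haW, hWΩ, hβ, hsol⟩ :=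
    exists_contDiffOn_solution_normalEquation hΩ hψr ha₀ hinj hcl
  refine ⟨V, W, β, hV, haV, hW, haW, hWΩ, hβ, fun x hx => ⟨(hsol x hx).2.1, fun b hb => ?_⟩⟩
  rw [← (hsol x hx).2.2 b hb, mem_orthogonal_iff_re_inner_eq_zero]
  constructor
  · intro h y
    rw [hfd _ (hsol x hx).1]
    exact h _ ⟨y, rfl⟩
  · rintro h _ ⟨y, rfl⟩
    rw [ContinuousLinearMap.coe_coe, ← hfd _ (hsol x hx).1]
    exact h y

end Orthogonality

/-! ### Chart parametrizations and tangent spaces -/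

section Charts

variable {𝕜 : Type*} [RCLike 𝕜]
  {E : Type*} [NormedAddCommGroup E] [InnerProductSpace 𝕜 E]
  {F : Type*} [NormedAddCommGroup F] [NormedSpace 𝕜 F]
  {M : Set E} [ChartedSpace F M]

variable (F) in
/-- The parametrization of `M` around `p₀` by the inverse of the preferred chart. -/
def chartParam (p₀ : M) (a : F) : E := ((chartAt F p₀).symm a : M)

theorem chartParam_mem (p₀ : M) (a : F) : chartParam F p₀ a ∈ M := Subtype.coe_prop _

theorem chartParam_chartAt {p₀ p : M} (hp : p ∈ (chartAt F p₀).source) :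
    chartParam F p₀ (chartAt F p₀ p) = p := by
  rw [chartParam, (chartAt F p₀).left_inv hp]

theorem contDiffOn_chartParam (hM : IsEmbeddedSubmanifold 𝕜 F M) (p₀ : M) :
    ContDiffOn 𝕜 ∞ (chartParam F p₀) (chartAt F p₀).target := by
  have := hM.isManifold
  rw [← contMDiffOn_iff_contDiffOn]
  exact hM.contMDiff_val.comp_contMDiffOn (contMDiffOn_chart_symm (I := 𝓘(𝕜, F)))

theorem differentiableAt_chartParam (hM : IsEmbeddedSubmanifold 𝕜 F M) (p₀ : M) {a : F}
    (ha : a ∈ (chartAt F p₀).target) : DifferentiableAt 𝕜 (chartParam F p₀) a :=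
  ((contDiffOn_chartParam hM p₀).contDiffAt
    ((chartAt F p₀).open_target.mem_nhds ha)).differentiableAt (by simp)

/-- The chain rule applies both ways, `val = ψ ∘ φ` near `p` and `ψ = val ∘ φ.symm`, giving the two
inclusions. Thus a single `ψ` describes the tangent spaces at all points of the patch. -/
theorem tangentSubspace_eq_range_fderiv (hM : IsEmbeddedSubmanifold 𝕜 F M) {p₀ p : M}
    (hp : p ∈ (chartAt F p₀).source) :
    tangentSubspace 𝕜 F p =
      LinearMap.range (fderiv 𝕜 (chartParam F p₀) (chartAt F p₀ p)).toLinearMap := by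
  have := hM.isManifold
  set φ := chartAt F p₀ with hφ
  have hta : φ p ∈ φ.target := φ.map_source hp
  have hval : MDifferentiableAt 𝓘(𝕜, F) 𝓘(𝕜, E) (Subtype.val : M → E) p :=
    (hM.contMDiff_val p).mdifferentiableAt (by simp)
  have hψ : HasMFDerivAt 𝓘(𝕜, F) 𝓘(𝕜, E) (chartParam F p₀) (φ p)
      (fderiv 𝕜 (chartParam F p₀) (φ p) : F →L[𝕜] E) :=
    (differentiableAt_chartParam hM p₀ hta).hasFDerivAt.hasMFDerivAt
  have hφd : MDifferentiableAt 𝓘(𝕜, F) 𝓘(𝕜, F) φ p :=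
    mdifferentiableAt_atlas (chart_mem_atlas F p₀) hp
  have hφs : MDifferentiableAt 𝓘(𝕜, F) 𝓘(𝕜, F) φ.symm (φ p) :=
    mdifferentiableAt_atlas_symm (chart_mem_atlas F p₀) hta
  have hleft : φ.symm (φ p) = p := φ.left_inv hp
  have h1 : mfderiv 𝓘(𝕜, F) 𝓘(𝕜, E) (Subtype.val : M → E) p =
      (fderiv 𝕜 (chartParam F p₀) (φ p)).comp (mfderiv 𝓘(𝕜, F) 𝓘(𝕜, F) φ p) := by
    refine ((hψ.comp p hφd.hasMFDerivAt).congr_of_eventuallyEq ?_).mfderiv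
    filter_upwards [φ.open_source.mem_nhds hp] with q hq
    exact (chartParam_chartAt hq).symm
  have h2 : fderiv 𝕜 (chartParam F p₀) (φ p) =
      (mfderiv 𝓘(𝕜, F) 𝓘(𝕜, E) (Subtype.val : M → E) p).comp
        (mfderiv 𝓘(𝕜, F) 𝓘(𝕜, F) φ.symm (φ p)) := by
    have hv : HasMFDerivAt 𝓘(𝕜, F) 𝓘(𝕜, E) (Subtype.val : M → E) (φ.symm (φ p))
        (mfderiv 𝓘(𝕜, F) 𝓘(𝕜, E) (Subtype.val : M → E) p) := by
      rw [hleft]; exact hval.hasMFDerivAt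
    exact hasMFDerivAt_unique hψ (hv.comp (φ p) hφs.hasMFDerivAt)
  apply le_antisymm
  · rintro _ ⟨y, rfl⟩
    rw [h1]
    exact ⟨mfderiv 𝓘(𝕜, F) 𝓘(𝕜, F) φ p y, rfl⟩
  · rintro _ ⟨y, rfl⟩
    rw [h2]
    exact ⟨mfderiv 𝓘(𝕜, F) 𝓘(𝕜, F) φ.symm (φ p) y, rfl⟩

/-- `mfderiv` at `p₀` is computed in the preferred chart at `p₀`, so the two sides unfold to the
same thing. This transfers injectivity and closed range to `Dψ(a₀)`. -/
theorem fderiv_chartParam_self (hM : IsEmbeddedSubmanifold 𝕜 F M) (p₀ : M) :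
    fderiv 𝕜 (chartParam F p₀) (chartAt F p₀ p₀) =
      mfderiv 𝓘(𝕜, F) 𝓘(𝕜, E) (Subtype.val : M → E) p₀ := by
  have hval : MDifferentiableAt 𝓘(𝕜, F) 𝓘(𝕜, E) (Subtype.val : M → E) p₀ :=
    (hM.contMDiff_val p₀).mdifferentiableAt (by simp)
  rw [hval.mfderiv]
  simp only [modelWithCornersSelf_coe, Set.range_id, fderivWithin_univ]
  rfl

end Charts

/-! ### The smallest normal vector near a zero tangent vector -/

section Local

variable {𝕜 : Type*} [RCLike 𝕜]
  {E : Type*} [NormedAddCommGroup E] [InnerProductSpace 𝕜 E]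
  [NormedSpace ℝ E] [IsScalarTower ℝ 𝕜 E]
  {F : Type*} [NormedAddCommGroup F] [NormedSpace 𝕜 F] [CompleteSpace F]
  {M : Set E} [ChartedSpace F M]

/-- If `f` takes values in `Kᗮ` near `x`, its derivative kills every vector it maps into `K`. -/
theorem fderiv_apply_eq_zero_of_eventually_mem_orthogonal {K : Submodule 𝕜 E} {f : E → E} {x : E}
    {D : E →L[ℝ] E} (hf : HasFDerivAt f D x) (hK : ∀ᶠ y in 𝓝 x, f y ∈ Kᗮ) {u : E}
    (hu : D u ∈ K) : D u = 0 := by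
  -- Pairing with `D u ∈ K` kills `f` near `x`, hence kills `D`; evaluating at `u` gives `⟪D u, D u⟫
  -- = 0`.
  let L : E →L[ℝ] 𝕜 := (innerSL 𝕜 (D u)).restrictScalars ℝ
  have h1 : HasFDerivAt (fun y => L (f y)) (L.comp D) x := L.hasFDerivAt.comp x hf
  have h2 : HasFDerivAt (fun y => L (f y)) (0 : E →L[ℝ] 𝕜) x := by
    refine (hasFDerivAt_const (0 : 𝕜) x).congr_of_eventuallyEq ?_
    filter_upwards [hK] with y hy
    exact (Submodule.mem_orthogonal _ _).1 hy _ hu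
  have h3 : L (D u) = 0 := congrArg (fun T : E →L[ℝ] 𝕜 => T u) (h1.unique h2)
  exact inner_self_eq_zero.1 h3

/-- Near a zero tangent vector the smallest normal vector exists, is unique, and is given by a
smooth function on an open subset of `E × E` whose derivative in tangent directions vanishes at
zero vectors. -/
theorem exists_contDiffOn_smallestNormal [CompleteSpace E]
    (hM : IsEmbeddedSubmanifold 𝕜 F M) (p₀ : M) :
    ∃ (N : Set (M × E)) (O : Set (E × E)) (η : E × E → E), IsOpen N ∧ (p₀, 0) ∈ N ∧ IsOpen O ∧
      ContDiffOn ℝ ∞ η O ∧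
      (∀ x ∈ N, ((x.1 : E), x.2) ∈ O ∧
        ∀ w, IsSmallestNormal 𝕜 F x.1 x.2 w ↔ w = η ((x.1 : E), x.2)) ∧
      ∀ p : M, (p, (0 : E)) ∈ N → η ((p : E), 0) = 0 ∧
        ∃ D : E →L[ℝ] E, HasFDerivAt (fun v => η ((p : E), v)) D 0 ∧
          ∀ u ∈ tangentSubspace 𝕜 F p, D u = 0 := by
  let _ : NormedSpace ℝ F := NormedSpace.restrictScalars ℝ 𝕜 F
  have : IsScalarTower ℝ 𝕜 F := RestrictScalars.isScalarTower ℝ 𝕜 F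
  set φ := chartAt F p₀ with hφ
  set ψ := chartParam F p₀ with hψ
  have hp₀ : p₀ ∈ φ.source := mem_chart_source F p₀
  have hψs : ContDiffOn 𝕜 ∞ ψ φ.target := contDiffOn_chartParam hM p₀
  have hψr : ContDiffOn ℝ ∞ ψ φ.target := hψs.restrict_scalars ℝ
  have hψφ : ∀ {p : M}, p ∈ φ.source → ψ (φ p) = p := fun hp => chartParam_chartAt hp
  have hinj : Function.Injective (fderiv 𝕜 ψ (φ p₀)) := by
    rw [fderiv_chartParam_self hM]
    exact hM.injective_mfderiv p₀
  have hcl : IsClosed (Set.range (fderiv 𝕜 ψ (φ p₀))) := by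
    rw [fderiv_chartParam_self hM]
    exact hM.isClosed_tangentSubspace p₀
  obtain ⟨⟨V, W, β, hV, haV, hW, haW, hWΩ, hβ, hsol⟩, O, W₁, ρ, hO, hW₁, haW₁, hρ, hρψ⟩ :=
    exists_normalSolution_leftInverse φ.open_target hψs (φ.map_source hp₀) hinj hcl
  have hβ₀ : ∀ a ∈ W, (a, (0 : E)) ∈ V → β (a, 0) = a := fun a ha haV =>
    (((hsol _ haV).2 a ha).1 (by simp)).symm
  -- The subspace topology enters here: points of `M` that are close to `p₀` in `E` cannot lie on
  -- another sheet.
  obtain ⟨ε, hε, hball⟩ : ∃ ε > 0, ∀ q : M, ‖(q : E) - p₀‖ < ε → q ∈ φ.source ∧ φ q ∈ W := by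
    have h1 : ∀ᶠ q in 𝓝 p₀, q ∈ φ.source ∧ φ q ∈ W :=
      (φ.open_source.eventually_mem hp₀).and
        ((φ.continuousAt hp₀).eventually_mem (hW.mem_nhds haW))
    obtain ⟨ε, hε, h⟩ := Metric.eventually_nhds_iff.1 h1
    exact ⟨ε, hε, fun q hq => h (by rwa [Subtype.dist_eq, dist_eq_norm])⟩
  -- Replacing the chart by the ambient map `ρ` defines `η` on an open subset of `E × E`, as
  -- `IsSmoothOn` requires.
  let O' : Set (E × E) := (O ×ˢ Set.univ) ∩ (fun z : E × E => (ρ z.1, z.2)) ⁻¹' V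
  let η : E × E → E := fun z => ψ (β (ρ z.1, z.2)) - z.1 - z.2
  have hρ' : ContDiffOn ℝ ∞ (fun z : E × E => (ρ z.1, z.2)) (O ×ˢ Set.univ) :=
    (hρ.comp contDiffOn_fst fun z hz => hz.1).prodMk contDiffOn_snd
  have hO' : IsOpen O' := hρ'.continuousOn.isOpen_inter_preimage (hO.prod isOpen_univ) hV
  have hη : ContDiffOn ℝ ∞ η O' := by
    have h1 : ContDiffOn ℝ ∞ (fun z : E × E => β (ρ z.1, z.2)) O' :=
      hβ.comp (hρ'.mono Set.inter_subset_left) fun z hz => hz.2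
    exact ((hψr.comp h1 fun z hz => hWΩ (hsol _ hz.2).1).sub contDiffOn_fst).sub contDiffOn_snd
  let ι : M × E → E × E := fun x => ((x.1 : E), x.2)
  have hι : Continuous ι := by fun_prop
  have hbase : ι (p₀, 0) ∈ O' := by
    have h1 := hρψ _ haW₁
    rw [hψφ hp₀] at h1
    refine ⟨⟨h1.1, trivial⟩, ?_⟩
    change (ρ p₀, (0 : E)) ∈ V
    rwa [h1.2]
  have hη₀ : η (ι (p₀, 0)) = 0 := by
    have h1 := hρψ _ haW₁
    rw [hψφ hp₀] at h1
    simp only [η, ι, h1.2, hβ₀ _ haW haV, hψφ hp₀, sub_self]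
  -- The last bound puts `p + v + w` within `ε` of `p₀` whenever `‖w‖ ≤ ‖η‖`.
  have hev : ∀ᶠ x in 𝓝 ((p₀, 0) : M × E), x.1 ∈ φ.source ∧ φ x.1 ∈ W ∧ φ x.1 ∈ W₁ ∧
      ι x ∈ O' ∧ ‖(x.1 : E) + x.2 - p₀‖ + ‖η (ι x)‖ < ε := by
    have hfst : Filter.Tendsto Prod.fst (𝓝 ((p₀, 0) : M × E)) (𝓝 p₀) := continuous_fst.continuousAt
    have hφc := (φ.continuousAt hp₀).tendsto.comp hfst
    have hηc : ContinuousAt (fun x => η (ι x)) ((p₀, 0) : M × E) :=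
      ContinuousAt.comp (f := ι) (hη.continuousOn.continuousAt (hO'.mem_nhds hbase))
        hι.continuousAt
    have hc : ContinuousAt (fun x : M × E => ‖(x.1 : E) + x.2 - p₀‖ + ‖η (ι x)‖) (p₀, 0) :=
      ContinuousAt.add (Continuous.continuousAt (by fun_prop)) hηc.norm
    refine (hfst.eventually_mem (φ.open_source.mem_nhds hp₀)).and
      ((hφc.eventually_mem (hW.mem_nhds haW)).and ((hφc.eventually_mem (hW₁.mem_nhds haW₁)).and
      ((hι.continuousAt.eventually_mem (hO'.mem_nhds hbase)).and
        (hc.eventually_mem (Iio_mem_nhds ?_)))))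
    simpa [hη₀] using hε
  obtain ⟨N, hN, hNo, hpN⟩ := mem_nhds_iff.1 hev
  have hρφ : ∀ x ∈ N, ρ x.1 = φ x.1 := fun x hx => by
    have h1 := (hρψ _ (hN hx).2.2.1).2
    rwa [hψφ (hN hx).1] at h1
  have hVx : ∀ x ∈ N, (φ x.1, x.2) ∈ V := fun x hx => by
    have h1 : (ρ x.1, x.2) ∈ V := (hN hx).2.2.2.1.2
    rwa [hρφ x hx] at h1
  have hηx : ∀ x ∈ N, η (ι x) = ψ (β (φ x.1, x.2)) - x.1 - x.2 := fun x hx => by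
    simp only [η, ι, hρφ x hx]
  have hnormal : ∀ x ∈ N, normalSubspace 𝕜 F x.1 =
      (LinearMap.range (fderiv 𝕜 ψ (φ x.1)).toLinearMap)ᗮ := fun x hx => by
    rw [normalSubspace, tangentSubspace_eq_range_fderiv hM (hN hx).1]
  refine ⟨N, O', η, hNo, hpN, hO', hη, fun x hx => ⟨(hN hx).2.2.2.1, ?_⟩, fun p hp => ?_⟩
  · have hmem : η (ι x) ∈ normalSubspace 𝕜 F x.1 := by
      rw [hnormal x hx, hηx x hx, ← hψφ (hN hx).1]
      exact ((hsol _ (hVx x hx)).2 _ (hsol _ (hVx x hx)).1).2 rfl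
    have hinM : (x.1 : E) + x.2 + η (ι x) ∈ M := by
      rw [hηx x hx]
      convert chartParam_mem p₀ (β (φ x.1, x.2)) using 1
      abel
    -- This one claim yields both minimality of `η` and uniqueness of the minimizer.
    have huniq : ∀ w ∈ normalSubspace 𝕜 F x.1, (x.1 : E) + x.2 + w ∈ M → ‖w‖ ≤ ‖η (ι x)‖ →
        w = η (ι x) := by
      intro w hw hwM hle
      have hq := hball ⟨_, hwM⟩ (by
        calc ‖(x.1 : E) + x.2 + w - p₀‖ = ‖((x.1 : E) + x.2 - p₀) + w‖ := by congr 1; abel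
          _ ≤ ‖(x.1 : E) + x.2 - p₀‖ + ‖w‖ := norm_add_le _ _
          _ < ε := (add_le_add_right hle _).trans_lt (hN hx).2.2.2.2)
      have hq' : ψ (φ ⟨_, hwM⟩) = (x.1 : E) + x.2 + w := hψφ hq.1
      have hb := ((hsol _ (hVx x hx)).2 _ hq.2).1 (by
        rw [hq', hψφ (hN hx).1, ← hnormal x hx]
        convert hw using 1
        abel)
      rw [hηx x hx, ← hb, hq']
      abel
    intro w
    constructor
    · exact fun h => huniq w h.1 h.2.1 (h.2.2 _ hmem hinM)
    · rintro rfl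
      refine ⟨hmem, hinM, fun w' hw' hwM' => ?_⟩
      by_contra hlt
      rw [not_le] at hlt
      rw [huniq w' hw' hwM' hlt.le] at hlt
      exact lt_irrefl _ hlt
  · have hpW := (hN hp).2.1
    have hpV : (φ p, (0 : E)) ∈ V := hVx _ hp
    have hps : p ∈ φ.source := (hN hp).1
    have hb0 : β (φ p, 0) = φ p := hβ₀ _ hpW hpV
    have hηp : ∀ v, η ((p : E), v) = ψ (β (φ p, v)) - ψ (φ p) - v := fun v => by
      rw [hψφ hps]
      simp only [η, hρφ _ hp]
    refine ⟨by rw [hηp, hb0]; simp, ?_⟩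
    have hβd : HasFDerivAt (fun v => β (φ p, v))
        ((fderiv ℝ β (φ p, 0)).comp (ContinuousLinearMap.inr ℝ F E)) 0 :=
      HasFDerivAt.comp (0 : E) (f := fun v => (φ p, v))
        ((hβ.contDiffAt (hV.mem_nhds hpV)).differentiableAt (by simp)).hasFDerivAt
        (hasFDerivAt_prodMk_right (φ p) 0)
    set β' := (fderiv ℝ β (φ p, 0)).comp (ContinuousLinearMap.inr ℝ F E)
    have hψd : HasFDerivAt ψ ((fderiv 𝕜 ψ (φ p)).restrictScalars ℝ) (β (φ p, 0)) := by
      rw [hb0]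
      exact (differentiableAt_chartParam hM p₀ (φ.map_source hps)).hasFDerivAt.restrictScalars ℝ
    have hd : HasFDerivAt (fun v => η ((p : E), v))
        (((fderiv 𝕜 ψ (φ p)).restrictScalars ℝ).comp β' - ContinuousLinearMap.id ℝ E) 0 := by
      simp only [hηp]
      exact ((hψd.comp (0 : E) hβd).sub_const _).sub (hasFDerivAt_id 0)
    refine ⟨_, hd, fun u hu => ?_⟩
    rw [tangentSubspace_eq_range_fderiv hM hps] at hu
    -- For tangent `u`, both `Dψ (β' u)` and `u` are tangent, hence so is their difference.
    refine fderiv_apply_eq_zero_of_eventually_mem_orthogonal hd ?_ (Submodule.sub_mem _ ?_ hu)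
    · have hc : ContinuousAt (fun v : E => (φ p, v)) 0 := by fun_prop
      filter_upwards [hc.eventually_mem (hV.mem_nhds hpV)] with v hv
      rw [hηp]
      exact ((hsol _ hv).2 _ (hsol _ hv).1).2 rfl
    · exact ⟨β' u, rfl⟩

end Local

/-! ### Local retractions and their union -/

section Retraction

variable {𝕜 : Type*} [RCLike 𝕜]
  {E : Type*} [NormedAddCommGroup E] [InnerProductSpace 𝕜 E]
  {F : Type*} [NormedAddCommGroup F] [NormedSpace 𝕜 F]
  {M : Set E} [ChartedSpace F M]

theorem isSmallestNormal_orthographicNormal {x : M × E}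
    (h : ∃! w : E, IsSmallestNormal 𝕜 F x.1 x.2 w) :
    IsSmallestNormal 𝕜 F x.1 x.2 (orthographicNormal 𝕜 F x) := by
  rw [orthographicNormal, dif_pos h]
  exact h.choose_spec.1

theorem IsOpenInTangentBundle.iUnion {ι : Sort*} {U : ι → Set (M × E)}
    (h : ∀ i, IsOpenInTangentBundle 𝕜 F (U i)) : IsOpenInTangentBundle 𝕜 F (⋃ i, U i) := by
  choose O hO hU using h
  refine ⟨⋃ i, O i, isOpen_iUnion hO, ?_⟩
  rw [Set.iUnion_inter]
  exact Set.iUnion_congr hU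

variable [NormedSpace ℝ E]

/-- Only smoothness needs care: an extension `g` for `U i` could disagree with `R` on some `U j`.
Its domain is cut down to an ambient open set whose points in the tangent bundle all belong to `U
i`. -/
theorem IsRetractionOn.iUnion {ι : Sort*} {R : M × E → E} {U : ι → Set (M × E)}
    (h : ∀ i, IsRetractionOn 𝕜 F R (U i)) : IsRetractionOn 𝕜 F R (⋃ i, U i) where
  isOpen := IsOpenInTangentBundle.iUnion fun i => (h i).isOpen
  mem x hx := by
    obtain ⟨i, hi⟩ := Set.mem_iUnion.1 hx
    exact (h i).mem x hi
  smooth x hx := by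
    obtain ⟨i, hi⟩ := Set.mem_iUnion.1 hx
    obtain ⟨O, g, hO, hxO, hg, hgR⟩ := (h i).smooth x hi
    obtain ⟨N, hN, hU⟩ := (h i).isOpen
    have hind : Topology.IsInducing fun y : M × E => ((y.1 : E), y.2) :=
      Topology.IsInducing.subtypeVal.prodMap Topology.IsInducing.id
    obtain ⟨O', hO', rfl⟩ := hind.isOpen_iff.1 hN
    refine ⟨O ∩ O', g, hO.inter hO', ⟨hxO, ?_⟩, hg.mono Set.inter_subset_left,
      fun y hy hyO => hgR y ?_ hyO.1⟩
    · rw [hU] at hi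
      exact hi.1
    · obtain ⟨j, hj⟩ := Set.mem_iUnion.1 hy
      obtain ⟨N', -, hU'⟩ := (h j).isOpen
      rw [hU'] at hj
      rw [hU]
      exact ⟨hyO.2, hj.2⟩
  map_zero p hp := by
    obtain ⟨i, hi⟩ := Set.mem_iUnion.1 hp
    exact (h i).map_zero p hi
  hasFDerivAt_zero p hp := by
    obtain ⟨i, hi⟩ := Set.mem_iUnion.1 hp
    exact (h i).hasFDerivAt_zero p hi

variable [CompleteSpace E] [IsScalarTower ℝ 𝕜 E] [CompleteSpace F]

theorem exists_isRetractionOn_orthographicMap (hM : IsEmbeddedSubmanifold 𝕜 F M) (p₀ : M) :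
    ∃ U : Set (M × E), (p₀, (0 : E)) ∈ U ∧
      (∀ x ∈ U, ∃! w : E, IsSmallestNormal 𝕜 F x.1 x.2 w) ∧
      (∀ p : M, (p, (0 : E)) ∈ U →
        HasFDerivAt (fun v : tangentSubspace 𝕜 F p => orthographicNormal 𝕜 F (p, (v : E)))
          (0 : tangentSubspace 𝕜 F p →L[𝕜] E) 0) ∧
      IsRetractionOn 𝕜 F (orthographicMap 𝕜 F : M × E → E) U := by
  obtain ⟨N, O, η, hN, hpN, hO, hη, hsm, hzero⟩ := exists_contDiffOn_smallestNormal hM p₀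
  have hex : ∀ x ∈ N, ∃! w : E, IsSmallestNormal 𝕜 F x.1 x.2 w := fun x hx =>
    ⟨η ((x.1 : E), x.2), ((hsm x hx).2 _).2 rfl, fun w hw => ((hsm x hx).2 w).1 hw⟩
  have heq : ∀ x ∈ N, orthographicNormal 𝕜 F x = η ((x.1 : E), x.2) := fun x hx =>
    ((hsm x hx).2 _).1 (isSmallestNormal_orthographicNormal (hex x hx))
  have hderiv : ∀ p : M, (p, (0 : E)) ∈ N →
      HasFDerivAt (fun v : tangentSubspace 𝕜 F p => orthographicNormal 𝕜 F (p, (v : E)))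
        (0 : tangentSubspace 𝕜 F p →L[𝕜] E) 0 := by
    intro p hp
    obtain ⟨-, D, hD, hD0⟩ := hzero p hp
    let S : tangentSubspace 𝕜 F p →L[ℝ] E := (tangentSubspace 𝕜 F p).subtypeL.restrictScalars ℝ
    have h1 : HasFDerivAt (fun v : tangentSubspace 𝕜 F p => η ((p : E), (v : E))) (D.comp S) 0 :=
      HasFDerivAt.comp (0 : tangentSubspace 𝕜 F p) (f := S) hD S.hasFDerivAt
    have h2 : HasFDerivAt (fun v : tangentSubspace 𝕜 F p => orthographicNormal 𝕜 F (p, (v : E)))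
        (D.comp S) 0 := by
      refine h1.congr_of_eventuallyEq ?_
      have hc : ContinuousAt (fun v : tangentSubspace 𝕜 F p => (p, (v : E))) 0 := by fun_prop
      filter_upwards [hc.eventually_mem (hN.mem_nhds hp)] with v hv
      exact heq _ hv
    -- The real derivative is zero, hence the restriction of a `𝕜`-linear map, so differentiability
    -- holds over `𝕜`.
    refine hasFDerivAt_of_restrictScalars ℝ h2 ?_
    ext v
    exact (hD0 v v.2).symm
  refine ⟨N ∩ tangentBundleSet 𝕜 F M, ⟨hpN, (tangentSubspace 𝕜 F p₀).zero_mem⟩, fun x hx => hex x hx.1,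
    fun p hp => hderiv p hp.1, ⟨N, hN, rfl⟩, fun x hx => ?_, fun x hx => ?_, fun p hp => ?_,
    fun p hp => ?_⟩
  · exact (isSmallestNormal_orthographicNormal (hex x hx.1)).2.1
  · refine ⟨O, fun z => z.1 + z.2 + η z, hO, (hsm x hx.1).1,
      (contDiffOn_fst.add contDiffOn_snd).add hη, fun y hy _ => ?_⟩
    simp only [orthographicMap, heq y hy.1]
  · simp only [orthographicMap, heq _ hp.1, (hzero p hp.1).1, add_zero]
  · have h := ((tangentSubspace 𝕜 F p).subtypeL.hasFDerivAt (x := 0)).const_add (p : E)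
    have h' := h.add (hderiv p hp.1)
    rw [add_zero] at h'
    exact h'

end Retraction

end Orthographic

theorem mainTheorem8
    {𝕜 : Type*} [RCLike 𝕜]
    {E : Type*} [NormedAddCommGroup E] [InnerProductSpace 𝕜 E] [CompleteSpace E]
    [NormedSpace ℝ E] [IsScalarTower ℝ 𝕜 E]
    {F : Type*} [NormedAddCommGroup F] [NormedSpace 𝕜 F] [CompleteSpace F]
    (M : Set E) [ChartedSpace F M]
    (hM : Orthographic.IsEmbeddedSubmanifold 𝕜 F M) :
    (∀ p₀ : M, ∃ U : Set (M × E),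
      Orthographic.IsOpenInTangentBundle 𝕜 F U ∧ (p₀, (0 : E)) ∈ U ∧
      (∀ x ∈ U, ∃! w : E, Orthographic.IsSmallestNormal 𝕜 F x.1 x.2 w) ∧
      (∀ p : M, (p, (0 : E)) ∈ U →
        HasFDerivAt
          (fun v : Orthographic.tangentSubspace 𝕜 F p =>
            Orthographic.orthographicNormal 𝕜 F (p, (v : E)))
          (0 : Orthographic.tangentSubspace 𝕜 F p →L[𝕜] E) 0) ∧
      Orthographic.IsRetractionOn 𝕜 F
        (Orthographic.orthographicMap 𝕜 F : M × E → E) U) ∧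
    (∃ U : Set (M × E),
      Orthographic.IsOpenInTangentBundle 𝕜 F U ∧ (∀ p : M, (p, (0 : E)) ∈ U) ∧
      (∀ x ∈ U, ∃! w : E, Orthographic.IsSmallestNormal 𝕜 F x.1 x.2 w) ∧
      Orthographic.IsRetractionOn 𝕜 F
        (Orthographic.orthographicMap 𝕜 F : M × E → E) U) := by
  choose U hU hex hderiv hR using Orthographic.exists_isRetractionOn_orthographicMap hM
  refine ⟨fun p₀ => ⟨U p₀, (hR p₀).isOpen, hU p₀, hex p₀, hderiv p₀, hR p₀⟩, ⋃ p₀, U p₀,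
    .iUnion fun p₀ => (hR p₀).isOpen, fun p => Set.mem_iUnion.2 ⟨p, hU p⟩, fun x hx => ?_,
    .iUnion hR⟩
  obtain ⟨p₀, hp₀⟩ := Set.mem_iUnion.1 hx
  exact hex p₀ x hp₀
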